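/- For non-zero integers $p,q,r$ let $P(p,q,r)$ be the pretzel link with three tassels. Its standard diagram consists of three vertical columns of $|p|,|q|,|r|$ crossings, neighbouring columns being joined (cyclically) at the top and at the bottom. In a column with positive entry the over-strand of every crossing is the one of slope $+1$ (running from south-west to north-east), in a column with negative entry it is the one of slope $-1$. (Thus $P(1,1,1)$ is the left-handed trefoil.) For odd $p,q,r$ this is a knot. Let $V$ be the Jones polynomial of oriented links, normalized by $V(\text{unknot})=1$ and $$t^{-1}V(L_+)-tV(L_-)+(t^{-1/2}-t^{1/2})V(L_0)=0 .$$ Equivalently, $V(L)=(-A)^{-3w(D)}\langle D\rangle$ with $t=A^{-4}$ for every oriented diagram $D$ of $L$, where $w$ is the writhe and $\langle\cdot\rangle$ is the Kauffman bracket. Theorem. Let $s\ge 1$ and $i$ be integers with $i>s+\tfrac32$. Then, for either orientation of the knot, the Jones polynomial of $P(-(2s+1),\,2s+1,\,2i+1)$ is $$1+t^{-2i-1}\Bigl[t^{2s+1}+t^{-(2s+1)}-(t+t^{-1})-2s+\sum_{j=1}^{2s}(-1)^{j+1}(2s+1-j)\,(t^j+t^{-j})\Bigr].$$ -/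

import Mathlib

open scoped LaurentPolynomial

/-- The four corners of a crossing drawn in the plane as the letter `X`.
In counterclockwise order they are `NE`, `NW`, `SW`, `SE`. -/
inductive Corner
  | NE
  | NW
  | SW
  | SE

/-- The other corner on the same diagonal, i.e. the other end of the same strand of the crossing. -/
def Corner.opposite : Corner → Corner
  | .NE => .SW
  | .NW => .SE
  | .SW => .NE
  | .SE => .NW

/-- Reflection in the vertical axis: the pairing `NW - NE`, `SW - SE`. -/
def Corner.flipH : Corner → Corner
  | .NE => .NW
  | .NW => .NE
  | .SW => .SE
  | .SE => .SW

/-- Reflection in the horizontal axis: the pairing `NW - SW`, `NE - SE`. -/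
def Corner.flipV : Corner → Corner
  | .NE => .SE
  | .NW => .SW
  | .SW => .NW
  | .SE => .NE

/-- A link diagram, given by its combinatorial (planar diagram) data: finitely many crossings, each
drawn as the letter `X`, the way in which their corners are joined by the arcs of the diagram, and
the number of components that pass through no crossing. Planarity of these data is not demanded: the
definitions below make sense without it, and a diagram drawn in the plane gives such data. -/
structure LinkDiagram where
  /-- the crossings -/
  Crossing : Type
  [fintypeCrossing : Fintype Crossing]
  [decEqCrossing : DecidableEq Crossing]
  /-- `true` if the over-strand of the crossing is its diagonal `SW - NE`,
  `false` if the over-strand is its diagonal `NW - SE` -/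
  slashOver : Crossing → Bool
  /-- the other end of the arc that starts at the given corner of the given crossing -/
  mate : Crossing × Corner → Crossing × Corner
  mate_mate : ∀ e, mate (mate e) = e
  mate_ne : ∀ e, mate e ≠ e
  /-- the number of components without crossings -/
  freeCircles : ℕ

namespace LinkDiagram

attribute [instance] fintypeCrossing decEqCrossing

/-- An orientation of all the components of a link diagram: `out (x, c)` says that the strand at
the corner `c` of the crossing `x` points away from the crossing. The components without crossings
play no role for the writhe, so their orientation is not recorded. -/
structure Orientation (D : LinkDiagram) where
  out : D.Crossing × Corner → Bool
  out_opposite : ∀ x c, out (x, c.opposite) = !(out (x, c))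
  out_mate : ∀ e, out (D.mate e) = !(out e)

/-- The sign of a crossing of an oriented diagram. If both strands point upwards or both point
downwards, then the crossing is positive exactly if the over-strand is `SW - NE`; if both point to
the left or both point to the right, it is positive exactly if the over-strand is `NW - SE`. -/
def Orientation.sign {D : LinkDiagram} (o : D.Orientation) (x : D.Crossing) : ℤ :=
  if D.slashOver x = (o.out (x, .NW) == o.out (x, .NE)) then 1 else -1

/-- The writhe: the sum of the signs of the crossings. -/
def Orientation.writhe {D : LinkDiagram} (o : D.Orientation) : ℤ :=
  ∑ x : D.Crossing, o.sign x

/-- How a state joins the corners of each crossing. `σ x = true` stands for the `A`-smoothing at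
`x`, which merges the two regions that the over-strand sweeps out when it is turned
counterclockwise; `σ x = false` stands for the `B`-smoothing, which merges the other two.
If the over-strand is `SW - NE`, then the `A`-smoothing merges the regions above and below, so it
joins `NW - SW` and `NE - SE`. -/
def smooth (D : LinkDiagram) (σ : D.Crossing → Bool) (e : D.Crossing × Corner) :
    D.Crossing × Corner :=
  if D.slashOver e.1 = σ e.1 then (e.1, e.2.flipV) else (e.1, e.2.flipH)

/-- The number of closed curves of the state `σ`: the classes of corners under the equivalence
relation generated by the arcs of the diagram and the smoothings, and the free circles. -/
noncomputable def loops (D : LinkDiagram) (σ : D.Crossing → Bool) : ℕ :=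
  Nat.card (Quot fun e f : D.Crossing × Corner => f = D.mate e ∨ f = D.smooth σ e) + D.freeCircles

/-- The variable `A` of the Kauffman bracket, as a unit of `ℤ[A, A⁻¹]`. -/
noncomputable def A : (ℤ[T;T⁻¹])ˣ where
  val := LaurentPolynomial.T 1
  inv := LaurentPolynomial.T (-1)
  val_inv := by rw [← LaurentPolynomial.T_add]; simp
  inv_val := by rw [← LaurentPolynomial.T_add]; simp

/-- The Kauffman bracket of a non-empty link diagram, normalized to be `1` on a circle without
crossings: the sum over all states of `A ^ (a - b) * (-A² - A⁻²) ^ (loops - 1)`, where `a` and `b`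
are the numbers of `A`- and `B`-smoothings of the state. -/
noncomputable def bracket (D : LinkDiagram) : ℤ[T;T⁻¹] :=
  ∑ σ : D.Crossing → Bool,
    ((A ^ (∑ x : D.Crossing, if σ x then (1 : ℤ) else -1) : (ℤ[T;T⁻¹])ˣ) : ℤ[T;T⁻¹]) *
      (-((A ^ (2 : ℤ) : (ℤ[T;T⁻¹])ˣ) : ℤ[T;T⁻¹]) - ((A ^ (-2 : ℤ) : (ℤ[T;T⁻¹])ˣ) : ℤ[T;T⁻¹])) ^
        (D.loops σ - 1)

/-- The Jones polynomial of the link with the diagram `D` and the orientation `o`, namely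
`(-A) ^ (-3 w) * ⟨D⟩` with `w` the writhe. The variable `t` of the Jones polynomial is `A⁻⁴`
(and `t ^ (1/2)` is `A⁻²`), so that `ℤ[t, t⁻¹]` and `ℤ[t ^ (1/2), t ^ (-1/2)]` are subrings
of `ℤ[A, A⁻¹]`. -/
noncomputable def jones (D : LinkDiagram) (o : D.Orientation) : ℤ[T;T⁻¹] :=
  (((-A) ^ (-3 * o.writhe) : (ℤ[T;T⁻¹])ˣ) : ℤ[T;T⁻¹]) * D.bracket

/-- The power `t ^ k` of the variable `t = A⁻⁴` of the Jones polynomial. -/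
noncomputable def tPow (k : ℤ) : ℤ[T;T⁻¹] :=
  (((A ^ (-4 : ℤ)) ^ k : (ℤ[T;T⁻¹])ˣ) : ℤ[T;T⁻¹])

end LinkDiagram

namespace Pretzel

/-- The crossings of the pretzel diagram with three tassels: `⟨c, k⟩` is the `k`-th crossing from
the top in the tassel number `c` from the left, and this tassel has `|p c|` crossings. -/
abbrev Crossing (p : Fin 3 → ℤ) : Type := Σ c : Fin 3, Fin (p c).natAbs

variable {p : Fin 3 → ℤ}

/-- The top crossing of a tassel. -/
def top (hp : ∀ c, p c ≠ 0) (c : Fin 3) : Crossing p :=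
  ⟨c, 0, Int.natAbs_pos.mpr (hp c)⟩

/-- The bottom crossing of a tassel. -/
def bottom (hp : ∀ c, p c ≠ 0) (c : Fin 3) : Crossing p :=
  ⟨c, (p c).natAbs - 1, Nat.sub_lt (Int.natAbs_pos.mpr (hp c)) one_pos⟩

/-- The arcs of the pretzel diagram. Inside a tassel the two lower corners of a crossing are joined
to the two upper corners of the crossing below it. At the top and at the bottom, the right corner
of each tassel is joined to the left corner of the next tassel on the right, cyclically. -/
def mate (hp : ∀ c, p c ≠ 0) : Crossing p × Corner → Crossing p × Corner
  | (⟨c, k⟩, .NW) =>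
      if (k : ℕ) = 0 then (top hp (c - 1), .NE) else (⟨c, k - 1, by omega⟩, .SW)
  | (⟨c, k⟩, .NE) =>
      if (k : ℕ) = 0 then (top hp (c + 1), .NW) else (⟨c, k - 1, by omega⟩, .SE)
  | (⟨c, k⟩, .SW) =>
      if h : (k : ℕ) + 1 < (p c).natAbs then (⟨c, k + 1, h⟩, .NW) else (bottom hp (c - 1), .SE)
  | (⟨c, k⟩, .SE) =>
      if h : (k : ℕ) + 1 < (p c).natAbs then (⟨c, k + 1, h⟩, .NE) else (bottom hp (c + 1), .SW)

theorem mate_mate (hp : ∀ c, p c ≠ 0) (e : Crossing p × Corner) : mate hp (mate hp e) = e := by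
  rcases e with ⟨⟨c, k, hk⟩, d⟩
  cases d <;> simp only [mate] <;> split_ifs with h
  · subst h
    change (top hp (c + 1 - 1), Corner.NE) = _
    rw [add_sub_cancel_right]; rfl
  · have : k - 1 + 1 = k := by omega
    simp [this, hk]
  · subst h
    change (top hp (c - 1 + 1), Corner.NW) = _
    rw [sub_add_cancel]; rfl
  · have : k - 1 + 1 = k := by omega
    simp [this, hk]
  · simp
  · obtain rfl : k = (p c).natAbs - 1 := by omega
    have h0 := Int.natAbs_pos.mpr (hp (c - 1))
    refine (dif_neg (by simp only; omega)).trans ?_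
    change (bottom hp (c - 1 + 1), Corner.SW) = _
    rw [sub_add_cancel]; rfl
  · simp
  · obtain rfl : k = (p c).natAbs - 1 := by omega
    have h0 := Int.natAbs_pos.mpr (hp (c + 1))
    refine (dif_neg (by simp only; omega)).trans ?_
    change (bottom hp (c + 1 - 1), Corner.SE) = _
    rw [add_sub_cancel_right]; rfl

theorem mate_ne (hp : ∀ c, p c ≠ 0) (e : Crossing p × Corner) : mate hp e ≠ e := by
  rcases e with ⟨⟨c, k, hk⟩, d⟩
  cases d <;> simp only [mate] <;> split_ifs <;> simp

variable (p) in
/-- The standard diagram of the pretzel link with the three (non-zero) numbers of crossings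
`p 0`, `p 1`, `p 2`. In the tassels with `p c > 0` the over-strands are the diagonals `SW - NE`,
in those with `p c < 0` they are the diagonals `NW - SE`. -/
def diagram (hp : ∀ c, p c ≠ 0) : LinkDiagram where
  Crossing := Crossing p
  slashOver x := decide (0 < p x.1)
  mate := mate hp
  mate_mate := mate_mate hp
  mate_ne := mate_ne hp
  freeCircles := 0

/-- The directions of the orientation of the diagram in which the two strands of each tassel are
antiparallel; at the top crossing of each tassel the strands enter on the left. -/
def antiparallelOut : Crossing p × Corner → Bool
  | (⟨_, k⟩, .NW) => decide ((k : ℕ) % 2 = 1)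
  | (⟨_, k⟩, .SW) => decide ((k : ℕ) % 2 = 1)
  | (⟨_, k⟩, .NE) => decide ((k : ℕ) % 2 = 0)
  | (⟨_, k⟩, .SE) => decide ((k : ℕ) % 2 = 0)

theorem antiparallelOut_opposite (x : Crossing p) (d : Corner) :
    antiparallelOut (x, d.opposite) = !antiparallelOut (x, d) := by
  rcases x with ⟨c, k, hk⟩
  cases d <;> simp [Corner.opposite, antiparallelOut, ← decide_not]

theorem antiparallelOut_mate (hp : ∀ c, p c ≠ 0) (hodd : ∀ c, Odd (p c))
    (e : Crossing p × Corner) : antiparallelOut (mate hp e) = !antiparallelOut e := by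
  rcases e with ⟨⟨c, k, hk⟩, d⟩
  have hm : ∀ c, (p c).natAbs % 2 = 1 := fun c => Nat.odd_iff.mp (Int.natAbs_odd.mpr (hodd c))
  have h0 := hm c
  have hb : ∀ c, ((p c).natAbs - 1) % 2 = 0 := fun c => by
    have := hm c
    omega
  have tNE : ∀ c, antiparallelOut (top hp c, .NE) = true := fun _ => rfl
  have tNW : ∀ c, antiparallelOut (top hp c, .NW) = false := fun _ => rfl
  have bSE : ∀ c, antiparallelOut (bottom hp c, .SE) = true := fun c => decide_eq_true (hb c)
  have bSW : ∀ c, antiparallelOut (bottom hp c, .SW) = false := fun c =>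
    decide_eq_false (fun h => by have h' := hb c; simp only at h; omega)
  cases d <;> simp only [mate] <;> split_ifs with h <;> rw [Bool.eq_iff_iff] <;>
    (try simp only [tNE, tNW, bSE, bSW]) <;> simp only [antiparallelOut, decide_eq_true_eq,
      Bool.not_eq_true', decide_eq_false_iff_not, true_iff, Bool.false_eq_true, false_iff] <;>
    omega

/-- If the three numbers are odd, then the diagram can be oriented with antiparallel strands in
each tassel. -/
def orientation (hp : ∀ c, p c ≠ 0) (hodd : ∀ c, Odd (p c)) : (diagram p hp).Orientation where
  out := antiparallelOut
  out_opposite := antiparallelOut_opposite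
  out_mate := antiparallelOut_mate hp hodd

end Pretzel

/-- The standard diagram of the pretzel link `P(a, b, c)`, for non-zero `a`, `b`, `c`. -/
def pretzel (a b c : ℤ) (ha : a ≠ 0) (hb : b ≠ 0) (hc : c ≠ 0) : LinkDiagram :=
  Pretzel.diagram ![a, b, c] (by intro j; fin_cases j <;> assumption)

/-! ### The closed curves of a state. -/

namespace Pretzel

variable {p : Fin 3 → ℤ}

/-! The Kauffman bracket of a three-column pretzel diagram has a closed form. In a given state, a
tassel with `h ≥ 1` horizontal smoothings splits off `h - 1` circles and otherwise acts as two
horizontal arcs; with `h = 0` it acts as two vertical arcs. Hence the number of curves is a count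
for one of eight small configurations plus a sum over the tassels (`loopEquiv`,
`card_quot_stateRel`, `gapCount_eq`), and the state sum factors over the tassels
(`bracket_diagram`). By the binomial theorem each factor is `A ^ q` in the vertical case and, after
multiplication by `δ`, `(-A ^ (-3)) ^ q - A ^ q` in the horizontal one. This gives
`delta_sq_mul_bracket`.

For odd columns every orientation makes the strands of each tassel antiparallel, so the writhe is
minus the sum of the entries (`writhe_eq`), here `-(2i+1)`. Put `a = 2s+1` and `X = t^a + t^(-a) +
2`. The opposite columns `-a` and `a` make most terms cancel, leaving `δ² V = δ² + t^(-2i-1) (δ² -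
1)(X - δ²)` with `δ² = t + t⁻¹ + 2` (`sq_delta_mul_jones_eq`). The alternating sum `S` in the claim
is a Fejér kernel at `-t`, with `δ² S = a δ² - X` (`fejer_sum_mul`). So both sides agree after
multiplication by `δ²`, and `δ` is not a zero divisor. -/

/-- The relation that joins the corners of the diagram along its arcs and along the smoothings of
the crossings, where `η x` tells whether the crossing `x` is smoothed horizontally. -/
def StateRel (hp : ∀ c, p c ≠ 0) (η : Crossing p → Bool) (e f : Crossing p × Corner) : Prop :=
  f = mate hp e ∨ f = (e.1, if η e.1 then e.2.flipH else e.2.flipV)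

/-- Whether the tassel `c` has a `j`-th crossing that is smoothed horizontally. -/
def IsHoriz (η : Crossing p → Bool) (c : Fin 3) (j : ℕ) : Prop :=
  ∃ h : j < (p c).natAbs, η ⟨c, j, h⟩ = true

instance (η : Crossing p → Bool) (c : Fin 3) : DecidablePred (IsHoriz η c) :=
  fun j => inferInstanceAs (Decidable (∃ h : j < (p c).natAbs, η ⟨c, j, h⟩ = true))

/-- The number of horizontally smoothed crossings of a tassel. -/
def horizCount (η : Crossing p → Bool) (c : Fin 3) : ℕ :=
  Nat.count (IsHoriz η c) (p c).natAbs

/-- The relation on the six regions between neighbouring tassels, `(c, false)` at the top and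
`(c, true)` at the bottom between the tassels `c` and `c + 1`, that is induced by replacing each
tassel `c` by two horizontal arcs (if `b c`) or by two vertical arcs (otherwise). -/
def GapRel (b : Fin 3 → Bool) (x y : Fin 3 × Bool) : Prop :=
  ∃ c, if b c then x.1 = c - 1 ∧ y.1 = c ∧ x.2 = y.2
    else (x.1 = c ∨ x.1 = c - 1) ∧ y.1 = x.1 ∧ x.2 = false ∧ y.2 = true

/-- The closed curves of a state, up to bijection: those that pass between the tassels, and those
between two consecutive horizontally smoothed crossings of a tassel. -/
abbrev LoopIndex (η : Crossing p → Bool) : Type :=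
  Quot (GapRel fun c => decide (0 < horizCount η c)) ⊕ Σ c, Fin (horizCount η c - 1)

/-- The gap on the left or on the right of a tassel. -/
def gap (c : Fin 3) : Bool → Fin 3
  | false => c - 1
  | true => c

/-- The closed curve through the side `s` of the tassel `c` at the height between its
crossings `j - 1` and `j`. -/
def loopAt (η : Crossing p → Bool) (c : Fin 3) (s : Bool) (j : ℕ) : LoopIndex η :=
  if h : Nat.count (IsHoriz η c) j = 0 then .inl (Quot.mk _ (gap c s, false))
  else if h' : horizCount η c ≤ Nat.count (IsHoriz η c) j then .inl (Quot.mk _ (gap c s, true))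
  else .inr ⟨c, Nat.count (IsHoriz η c) j - 1, by omega⟩

theorem loopAt_zero (η : Crossing p → Bool) (c : Fin 3) (s : Bool) :
    loopAt η c s 0 = .inl (Quot.mk _ (gap c s, false)) := by
  simp [loopAt]

theorem loopAt_natAbs (η : Crossing p → Bool) (c : Fin 3) (s : Bool) :
    loopAt η c s (p c).natAbs = .inl (Quot.mk _ (gap c s, true)) := by
  have e : Nat.count (IsHoriz η c) (p c).natAbs = horizCount η c := rfl
  unfold loopAt
  split_ifs with h h'
  -- Without horizontal smoothings `loopAt` names the top gap at every height; the vertical clause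
  -- of `GapRel` identifies it with the bottom gap.
  · refine congrArg _ (Quot.sound ⟨c, ?_⟩)
    have : ¬ 0 < horizCount η c := by omega
    cases s <;> simp [this, gap]
  · rfl
  · omega

theorem loopAt_congr (η : Crossing p → Bool) (c : Fin 3) (s : Bool) {j k : ℕ}
    (h : Nat.count (IsHoriz η c) j = Nat.count (IsHoriz η c) k) :
    loopAt η c s j = loopAt η c s k := by
  unfold loopAt
  simp only [h]

theorem loopAt_side (η : Crossing p → Bool) (c : Fin 3) (h : 0 < horizCount η c) (j : ℕ) :
    loopAt η c false j = loopAt η c true j := by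
  have key : ∀ l, (Quot.mk (GapRel fun c => decide (0 < horizCount η c)) (c - 1, l)) =
      Quot.mk _ (c, l) := fun l => Quot.sound ⟨c, by simp [h]⟩
  unfold loopAt
  simp only [gap, key]

theorem gap_true_sub (c : Fin 3) : gap (c - 1) true = gap c false := rfl

theorem gap_false_add (c : Fin 3) : gap (c + 1) false = gap c true := by simp [gap]

/-- Whether the corner is on the right. -/
def _root_.Corner.isEast : Corner → Bool
  | .NE => true
  | .SE => true
  | .NW => false
  | .SW => false

/-- The height of a corner of the `k`-th crossing. -/
def _root_.Corner.height (k : ℕ) : Corner → ℕ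
  | .NE => k
  | .NW => k
  | .SE => k + 1
  | .SW => k + 1

/-- The closed curve through a corner. -/
def loopOf (η : Crossing p → Bool) (e : Crossing p × Corner) : LoopIndex η :=
  loopAt η e.1.1 e.2.isEast (e.2.height e.1.2)

theorem loopOf_mate (hp : ∀ c, p c ≠ 0) (η : Crossing p → Bool) (e : Crossing p × Corner) :
    loopOf η (mate hp e) = loopOf η e := by
  have h0 : ∀ c, (p c).natAbs - 1 + 1 = (p c).natAbs := fun c => by
    have := Int.natAbs_pos.mpr (hp c)
    omega
  rcases e with ⟨⟨c, k, hk⟩, d⟩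
  cases d <;> simp only [mate] <;> split_ifs with h <;>
    simp only [loopOf, top, bottom, Corner.isEast, Corner.height, h0]
  · subst h
    simp only [loopAt_zero, gap_false_add]
  · rw [Nat.sub_add_cancel (by omega)]
  · subst h
    simp only [loopAt_zero, gap_true_sub]
  · rw [Nat.sub_add_cancel (by omega)]
  · obtain rfl : k = (p c).natAbs - 1 := by omega
    simp only [h0, loopAt_natAbs, gap_true_sub]
  · obtain rfl : k = (p c).natAbs - 1 := by omega
    simp only [h0, loopAt_natAbs, gap_false_add]

theorem horizCount_pos {η : Crossing p → Bool} {c : Fin 3} {k : ℕ} (h : IsHoriz η c k) :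
    0 < horizCount η c :=
  (Nat.zero_le _).trans_lt (Nat.count_strict_mono h h.1)

theorem loopOf_smooth (η : Crossing p → Bool) (e : Crossing p × Corner) :
    loopOf η (e.1, if η e.1 then e.2.flipH else e.2.flipV) = loopOf η e := by
  rcases e with ⟨⟨c, k, hk⟩, d⟩
  by_cases h : η ⟨c, k, hk⟩ = true
  · have h1 := loopAt_side η c (horizCount_pos ⟨hk, h⟩)
    cases d <;> simp [h, Corner.flipH, loopOf, Corner.isEast, Corner.height, h1]
  · have h1 : ∀ s, loopAt η c s (k + 1) = loopAt η c s k := fun s => loopAt_congr η c s <| by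
      rw [Nat.count_succ, if_neg, add_zero]
      rintro ⟨_, h'⟩
      exact h h'
    cases d <;> simp [h, Corner.flipV, loopOf, Corner.isEast, Corner.height, h1]

theorem loopOf_eq_of_rel (hp : ∀ c, p c ≠ 0) (η : Crossing p → Bool) (e f : Crossing p × Corner)
    (h : StateRel hp η e f) : loopOf η e = loopOf η f := by
  rcases h with rfl | rfl
  · exact (loopOf_mate hp η e).symm
  · exact (loopOf_smooth η e).symm

/-- The class of the corners on the side `s` of the tassel `c` between its crossings
`j - 1` and `j`. -/
def classAt (hp : ∀ c, p c ≠ 0) (η : Crossing p → Bool) (c : Fin 3) (s : Bool) (j : ℕ) :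
    Quot (StateRel hp η) :=
  Quot.mk _ (if h : j < (p c).natAbs then (⟨c, j, h⟩, cond s .NE .NW)
    else (bottom hp c, cond s .SE .SW))

theorem classAt_natAbs (hp : ∀ c, p c ≠ 0) (η : Crossing p → Bool) (c : Fin 3) (s : Bool) :
    classAt hp η c s (p c).natAbs = Quot.mk _ (bottom hp c, cond s .SE .SW) := by
  simp [classAt]

/-- A lower corner is joined to the upper corner of the next crossing, so tassel, side and height
determine the class; only the bottom crossing needs the default value in `classAt`. -/
theorem mk_eq_classAt (hp : ∀ c, p c ≠ 0) (η : Crossing p → Bool) (e : Crossing p × Corner) :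
    (Quot.mk _ e : Quot (StateRel hp η)) =
      classAt hp η e.1.1 e.2.isEast (e.2.height e.1.2) := by
  rcases e with ⟨⟨c, k, hk⟩, d⟩
  cases d
  case NE => simp [classAt, Corner.isEast, Corner.height, hk]
  case NW => simp [classAt, Corner.isEast, Corner.height, hk]
  case SE =>
    change _ = classAt hp η c true (k + 1)
    by_cases h : k + 1 < (p c).natAbs
    · simp only [classAt, dif_pos h]
      exact Quot.sound (Or.inl (by simp [mate, h]))
    · obtain rfl : k = (p c).natAbs - 1 := by omega
      rw [Nat.sub_add_cancel (by omega), classAt_natAbs]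
      rfl
  case SW =>
    change _ = classAt hp η c false (k + 1)
    by_cases h : k + 1 < (p c).natAbs
    · simp only [classAt, dif_pos h]
      exact Quot.sound (Or.inl (by simp [mate, h]))
    · obtain rfl : k = (p c).natAbs - 1 := by omega
      rw [Nat.sub_add_cancel (by omega), classAt_natAbs]
      rfl

theorem classAt_smooth (hp : ∀ c, p c ≠ 0) (η : Crossing p → Bool) {c : Fin 3} {k : ℕ}
    (hk : k < (p c).natAbs) (h : ¬ IsHoriz η c k) (s : Bool) :
    classAt hp η c s k = classAt hp η c s (k + 1) := by
  have h' : η ⟨c, k, hk⟩ = false := by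
    rw [← Bool.not_eq_true]
    exact fun h' => h ⟨hk, h'⟩
  cases s
  · exact (mk_eq_classAt hp η (⟨c, k, hk⟩, .NW)).symm.trans <| .trans
      (Quot.sound (Or.inr (by simp [h', Corner.flipV]))) (mk_eq_classAt hp η (⟨c, k, hk⟩, .SW))
  · exact (mk_eq_classAt hp η (⟨c, k, hk⟩, .NE)).symm.trans <| .trans
      (Quot.sound (Or.inr (by simp [h', Corner.flipV]))) (mk_eq_classAt hp η (⟨c, k, hk⟩, .SE))

theorem classAt_side (hp : ∀ c, p c ≠ 0) (η : Crossing p → Bool) {c : Fin 3} {k : ℕ}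
    (h : IsHoriz η c k) (s t : Bool) :
    classAt hp η c s k = classAt hp η c t k ∧
      classAt hp η c s (k + 1) = classAt hp η c t (k + 1) := by
  obtain ⟨hk, h⟩ := h
  have h1 : classAt hp η c false k = classAt hp η c true k :=
    (mk_eq_classAt hp η (⟨c, k, hk⟩, .NW)).symm.trans <| .trans
      (Quot.sound (Or.inr (by simp [h, Corner.flipH]))) (mk_eq_classAt hp η (⟨c, k, hk⟩, .NE))
  have h2 : classAt hp η c false (k + 1) = classAt hp η c true (k + 1) :=
    (mk_eq_classAt hp η (⟨c, k, hk⟩, .SW)).symm.trans <| .trans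
      (Quot.sound (Or.inr (by simp [h, Corner.flipH]))) (mk_eq_classAt hp η (⟨c, k, hk⟩, .SE))
  cases s <;> cases t <;> simp [h1, h2]

/-- Equal counts mean that all crossings between the two heights are smoothed vertically, so the
side runs straight through. -/
theorem classAt_congr (hp : ∀ c, p c ≠ 0) (η : Crossing p → Bool) {c : Fin 3} {j k : ℕ}
    (hj : j ≤ (p c).natAbs) (hk : k ≤ (p c).natAbs)
    (h : Nat.count (IsHoriz η c) j = Nat.count (IsHoriz η c) k) (s : Bool) :
    classAt hp η c s j = classAt hp η c s k := by
  wlog hjk : j ≤ k generalizing j k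
  · exact (this hk hj h.symm (by omega)).symm
  induction k, hjk using Nat.le_induction with
  | base => rfl
  | succ k hjk ih =>
    have h1 := Nat.count_monotone (IsHoriz η c) hjk
    have h2 := Nat.count_succ (IsHoriz η c) k
    have h3 : ¬ IsHoriz η c k := fun h3 => by
      rw [if_pos h3] at h2
      omega
    rw [if_neg h3] at h2
    exact (ih (by omega) (by omega)).trans (classAt_smooth hp η (by omega) h3 s)

theorem classAt_gap_zero (hp : ∀ c, p c ≠ 0) (η : Crossing p → Bool) (c : Fin 3) (s : Bool) :
    classAt hp η (gap c s) true 0 = classAt hp η c s 0 := by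
  cases s
  · refine .trans ?_ (mk_eq_classAt hp η (top hp c, .NW))
    refine .trans (mk_eq_classAt hp η (top hp (c - 1), .NE)).symm ?_
    refine (Quot.sound (r := StateRel hp η) (Or.inl ?_)).symm
    simp [mate, top]
  · rfl

theorem classAt_gap_natAbs (hp : ∀ c, p c ≠ 0) (η : Crossing p → Bool) (c : Fin 3) (s : Bool) :
    classAt hp η (gap c s) true (p (gap c s)).natAbs = classAt hp η c s (p c).natAbs := by
  cases s
  · rw [classAt_natAbs, classAt_natAbs]
    refine (Quot.sound (r := StateRel hp η) (Or.inl ?_)).symm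
    have := Int.natAbs_pos.mpr (hp c)
    simp only [bottom, mate, cond_true, cond_false, gap]
    rw [dif_neg (by omega)]
  · rfl

/-- The count increases by at most one per crossing. The crossing found is the one that `Nat.nth`
returns, which keeps its default value out of play. -/
theorem exists_isHoriz (η : Crossing p → Bool) (c : Fin 3) {i : ℕ} (hi : i < horizCount η c) :
    ∃ k, IsHoriz η c k ∧ Nat.count (IsHoriz η c) k = i := by
  unfold horizCount at hi
  generalize (p c).natAbs = n at hi
  induction n with
  | zero => simp at hi
  | succ n ih =>
    by_cases h : i < Nat.count (IsHoriz η c) n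
    · exact ih h
    · rw [Nat.count_succ] at hi
      split_ifs at hi with h'
      · exact ⟨n, h', by omega⟩
      · omega

/-- The sides run straight from the top to the first horizontal smoothing, and from the last one to
the bottom; there the two sides are joined. -/
theorem classAt_ends (hp : ∀ c, p c ≠ 0) (η : Crossing p → Bool) {c : Fin 3}
    (hc : 0 < horizCount η c) : classAt hp η c false 0 = classAt hp η c true 0 ∧
      classAt hp η c false (p c).natAbs = classAt hp η c true (p c).natAbs := by
  constructor
  · obtain ⟨k, hk, h⟩ := exists_isHoriz η c hc
    have h' := classAt_congr hp η (Nat.zero_le _) hk.1.le ((Nat.count_zero _).trans h.symm)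
    rw [h', h', (classAt_side hp η hk _ _).1]
  · obtain ⟨k, hk, h⟩ := exists_isHoriz η c (Nat.sub_lt hc one_pos)
    have h' := classAt_congr hp η le_rfl (Nat.succ_le_of_lt hk.1) (show horizCount η c = _ by
      rw [Nat.count_succ, if_pos hk]
      omega)
    rw [h', h', (classAt_side hp η hk _ _).2]

/-- The class of corners that corresponds to an index. -/
noncomputable def loopInv (hp : ∀ c, p c ≠ 0) (η : Crossing p → Bool) : LoopIndex η → Quot (StateRel hp η)
  | .inl q => q.lift
      (fun x => classAt hp η x.1 true (if x.2 then (p x.1).natAbs else 0)) <| by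
        rintro ⟨g, l⟩ ⟨g', l'⟩ ⟨c, h⟩
        by_cases hc : 0 < horizCount η c
        · simp only [hc, decide_true, if_true] at h
          obtain ⟨rfl, rfl, rfl⟩ := h
          obtain ⟨h0, h1⟩ := classAt_ends hp η hc
          cases l
          · exact (classAt_gap_zero hp η g' false).trans h0
          · exact (classAt_gap_natAbs hp η g' false).trans h1
        · simp only [hc, decide_false, Bool.false_eq_true, if_false] at h
          obtain ⟨h, rfl, rfl, rfl⟩ := h
          have h' : ∀ s, classAt hp η c s 0 = classAt hp η c s (p c).natAbs := fun s =>
            classAt_congr hp η (Nat.zero_le _) le_rfl (by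
              change _ = horizCount η c
              simp; omega) s
          rcases h with rfl | rfl
          · simpa using h' true
          · have := (classAt_gap_zero hp η c false).trans
              ((h' false).trans (classAt_gap_natAbs hp η c false).symm)
            simpa [gap] using this
  | .inr ⟨c, i⟩ => classAt hp η c false (Nat.nth (IsHoriz η c) i + 1)

theorem loopInv_loopAt (hp : ∀ c, p c ≠ 0) (η : Crossing p → Bool) (c : Fin 3) (s : Bool) {j : ℕ}
    (hj : j ≤ (p c).natAbs) : loopInv hp η (loopAt η c s j) = classAt hp η c s j := by
  unfold loopAt
  split_ifs with h h'
  · exact (classAt_gap_zero hp η c s).trans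
      (classAt_congr hp η (Nat.zero_le _) hj ((Nat.count_zero _).trans h.symm) s)
  · exact (classAt_gap_natAbs hp η c s).trans
      (classAt_congr hp η le_rfl hj (le_antisymm h' (Nat.count_monotone _ hj)) s)
  · obtain ⟨k, hk, hk'⟩ := exists_isHoriz η c
      (show Nat.count (IsHoriz η c) j - 1 < horizCount η c by omega)
    simp only [loopInv]
    -- The crossing `k` is the last horizontally smoothed one above height `j`, so heights `k + 1`
    -- and `j` have the same count.
    rw [← hk', Nat.nth_count hk, (classAt_side hp η hk false s).2]
    refine classAt_congr hp η (Nat.succ_le_of_lt hk.1) hj ?_ s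
    rw [Nat.count_succ, if_pos hk]
    omega

/-- The closed curve of a class of corners. -/
def loopLift (hp : ∀ c, p c ≠ 0) (η : Crossing p → Bool) : Quot (StateRel hp η) → LoopIndex η :=
  Quot.lift (loopOf η) (loopOf_eq_of_rel hp η)

theorem loopLift_classAt (hp : ∀ c, p c ≠ 0) (η : Crossing p → Bool) (c : Fin 3) (s : Bool) {j : ℕ}
    (hj : j ≤ (p c).natAbs) : loopLift hp η (classAt hp η c s j) = loopAt η c s j := by
  unfold classAt
  split_ifs with h
  · cases s <;> rfl
  · obtain rfl : j = (p c).natAbs := by omega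
    have h0 : (p c).natAbs - 1 + 1 = (p c).natAbs := by
      have := Int.natAbs_pos.mpr (hp c)
      omega
    cases s <;> simp [loopLift, loopOf, bottom, Corner.isEast, Corner.height, h0]

/-- The closed curves of a state of the pretzel diagram. -/
noncomputable def loopEquiv (hp : ∀ c, p c ≠ 0) (η : Crossing p → Bool) :
    Quot (StateRel hp η) ≃ LoopIndex η where
  toFun := loopLift hp η
  invFun := loopInv hp η
  left_inv := by
    rintro ⟨e⟩
    refine (loopInv_loopAt hp η e.1.1 _ ?_).trans (mk_eq_classAt hp η e).symm
    rcases e with ⟨⟨c, k, hk⟩, d⟩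
    cases d <;> simp only [Corner.height] <;> omega
  right_inv := by
    rintro (⟨⟨g, l⟩⟩ | ⟨c, i, hi⟩)
    · cases l
      · exact (loopLift_classAt hp η g true (Nat.zero_le _)).trans (loopAt_zero η g true)
      · exact (loopLift_classAt hp η g true le_rfl).trans (loopAt_natAbs η g true)
    · obtain ⟨k, hk, hk'⟩ := exists_isHoriz η c (show i < horizCount η c by omega)
      simp only [loopInv]
      rw [show Nat.nth (IsHoriz η c) i = k by rw [← hk', Nat.nth_count hk],
        loopLift_classAt hp η c false (Nat.succ_le_of_lt hk.1)]
      have h1 : Nat.count (IsHoriz η c) (k + 1) = i + 1 := by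
        rw [Nat.count_succ, if_pos hk, hk']
      simp only [loopAt, h1]
      rw [dif_neg (by omega), dif_neg (by omega)]
      simp

/-! ### Counting the closed curves. -/

/-- The number of closed curves that pass between the tassels. -/
noncomputable def gapCount (b : Fin 3 → Bool) : ℕ :=
  Nat.card (Quot (GapRel b))

theorem card_quot_stateRel (hp : ∀ c, p c ≠ 0) (η : Crossing p → Bool) :
    Nat.card (Quot (StateRel hp η)) =
      gapCount (fun c => decide (0 < horizCount η c)) + ∑ c, (horizCount η c - 1) := by
  have : Finite (Quot (GapRel fun c => decide (0 < horizCount η c))) := Quot.finite _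
  rw [Nat.card_congr (loopEquiv hp η), LoopIndex, Nat.card_sum, gapCount]
  simp

theorem horizCount_eq_sum (η : Crossing p → Bool) (c : Fin 3) :
    horizCount η c = ∑ k : Fin (p c).natAbs, if η ⟨c, k⟩ then 1 else 0 := by
  rw [horizCount, Nat.count_eq_card_filter_range, Finset.card_filter, Finset.sum_range]
  refine Finset.sum_congr rfl fun k _ => ?_
  by_cases h : η ⟨c, k⟩ = true <;> simp [IsHoriz, h]

/-- A normal form embeds the quotient into the type itself, which turns its cardinality into a
decidable count. -/
theorem _root_.Nat.card_quot_of_normalForm {α : Type*} [Fintype α] [DecidableEq α]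
    (r : α → α → Prop) (f : α → α) (h : ∀ x y, r x y → f x = f y)
    (h' : ∀ x, Quot.mk r (f x) = Quot.mk r x) :
    Nat.card (Quot r) = (Finset.univ.image f).card := by
  have hinj : Function.Injective (Quot.lift f h) := by
    rintro ⟨x⟩ ⟨y⟩ hxy
    exact (h' x).symm.trans ((congrArg _ hxy).trans (h' y))
  have hr : Set.range (Quot.lift f h) = Finset.univ.image f := by
    rw [Set.range_quot_lift]
    simp
  rw [← Nat.card_range_of_injective hinj, hr, Nat.card_coe_set_eq, Set.ncard_coe_finset]

/-- A representative of the class of a gap. -/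
def gapRep (b : Fin 3 → Bool) (x : Fin 3 × Bool) : Fin 3 × Bool :=
  (match b 0, b 1, b 2 with
    | false, false, false => x.1
    | true, false, false => if x.1 = 2 then 0 else x.1
    | false, true, false => if x.1 = 0 then 1 else x.1
    | false, false, true => if x.1 = 1 then 2 else x.1
    | _, _, _ => 0,
   b 0 && b 1 && b 2 && x.2)

theorem gapCount_eq (x y z : Bool) :
    gapCount ![x, y, z] =
      if x && y && z then 2 else 3 - (x.toNat + y.toNat + z.toNat) := by
  have key := Nat.card_quot_of_normalForm (GapRel ![x, y, z]) (gapRep ![x, y, z])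
    (by
      rintro ⟨g, l⟩ ⟨g', l'⟩ ⟨c, h⟩
      revert g l g' l' c x y z
      simp only
      decide) (by
      -- The identifications made by each single tassel; chained together they move every gap to its
      -- representative.
      have h0 : ∀ c l, ![x, y, z] c = true →
          Quot.mk (GapRel ![x, y, z]) (c - 1, l) = Quot.mk _ (c, l) :=
        fun c l h => Quot.sound ⟨c, by simp [h]⟩
      have h1 : ∀ c, ![x, y, z] c = false →
          Quot.mk (GapRel ![x, y, z]) (c, false) = Quot.mk _ (c, true) :=
        fun c h => Quot.sound ⟨c, by simp [h]⟩
      have h2 : ∀ c, ![x, y, z] c = false →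
          Quot.mk (GapRel ![x, y, z]) (c - 1, false) = Quot.mk _ (c - 1, true) :=
        fun c h => Quot.sound ⟨c, by simp [h]⟩
      have a0 := fun l => h0 0 l
      have a1 := fun l => h0 1 l
      have a2 := fun l => h0 2 l
      have b0 := h1 0
      have b1 := h1 1
      have b2 := h1 2
      have c0 := h2 0
      have c1 := h2 1
      have c2 := h2 2
      simp only [show (0 : Fin 3) - 1 = 2 from rfl, show (1 : Fin 3) - 1 = 0 from rfl,
        show (2 : Fin 3) - 1 = 1 from rfl] at a0 a1 a2 c0 c1 c2
      clear h0 h1 h2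
      rintro ⟨g, l⟩
      cases x <;> cases y <;> cases z <;> simp at a0 a1 a2 b0 b1 b2 c0 c1 c2 <;>
        fin_cases g <;> cases l <;> simp [gapRep] <;> grind)
  rw [gapCount, key]
  clear key
  revert x y z
  decide

end Pretzel

/-! ### Factoring the state sum over the tassels. -/

namespace Pretzel

variable {p : Fin 3 → ℤ}

/-- The coupling factor `Φ` sees each `η i` only through one bit, so fixing these bits makes the sum
a product. -/
theorem sum_prod_indicator {R : Type*} [CommRing R] {ι : Type*} [Fintype ι] [DecidableEq ι]
    {κ : ι → Type*} [∀ i, Fintype (κ i)] (β : ∀ i, κ i → Bool) (Φ : (ι → Bool) → R)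
    (G : ∀ i, κ i → R) :
    ∑ η : ∀ i, κ i, Φ (fun i => β i (η i)) * ∏ i, G i (η i) =
      ∑ b : ι → Bool, Φ b * ∏ i, ∑ θ, if β i θ = b i then G i θ else 0 := by
  simp_rw [Finset.prod_univ_sum, Fintype.piFinset_univ, Finset.mul_sum]
  rw [Finset.sum_comm]
  refine Finset.sum_congr rfl fun η _ => ?_
  rw [Finset.sum_eq_single fun i => β i (η i)]
  · simp
  · intro b _ hb
    obtain ⟨i, hi⟩ := Function.ne_iff.mp hb
    rw [Finset.prod_eq_zero (Finset.mem_univ i) (if_neg (Ne.symm hi)), mul_zero]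
  · simp

/-- The number of horizontal smoothings among the smoothings of a tassel. -/
def trueCount {n : ℕ} (θ : Fin n → Bool) : ℕ :=
  ∑ k, if θ k then 1 else 0

/-- The contribution of the smoothings of a tassel of `n` crossings that contain a horizontal one
(if `b`) or contain none (otherwise); `u` and `v` are the weights of a vertical and of a horizontal
smoothing, and `δ` is that of a closed curve. -/
def tasselSum {R : Type*} [CommRing R] (n : ℕ) (u v δ : R) (b : Bool) : R :=
  ∑ θ : Fin n → Bool, if decide (0 < trueCount θ) = b then
    (∏ k, if θ k then v else u) * δ ^ (trueCount θ - 1) else 0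

theorem trueCount_eq_zero {n : ℕ} {θ : Fin n → Bool} :
    trueCount θ = 0 ↔ θ = fun _ => false := by
  simp [trueCount, funext_iff]

theorem tasselSum_false {R : Type*} [CommRing R] (n : ℕ) (u v δ : R) :
    tasselSum n u v δ false = u ^ n := by
  unfold tasselSum
  rw [Finset.sum_eq_single fun _ => false]
  · simp [trueCount]
  · intro θ _ hθ
    refine if_neg fun h => hθ (trueCount_eq_zero.mp ?_)
    simpa using h
  · simp

/-- The extra `δ` turns the exponent `h - 1` into `h`. Expanding `(u + δ v) ^ n` then gives all
states of the tassel, of which the all-vertical one is removed. -/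
theorem mul_tasselSum_true {R : Type*} [CommRing R] (n : ℕ) (u v δ : R) :
    δ * tasselSum n u v δ true = (u + δ * v) ^ n - u ^ n := by
  rw [eq_sub_iff_add_eq, ← tasselSum_false n u v δ]
  have key : (u + δ * v) ^ n = ∑ θ : Fin n → Bool, ∏ k, if θ k then δ * v else u := by
    have := Finset.prod_univ_sum (fun _ : Fin n => (Finset.univ : Finset Bool))
      (fun _ b => if b then δ * v else u)
    rw [Fintype.piFinset_univ] at this
    rw [← this]
    simp [add_comm]
  rw [key, tasselSum, tasselSum, Finset.mul_sum, ← Finset.sum_add_distrib]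
  refine Finset.sum_congr rfl fun θ _ => ?_
  have h : (∏ k, if θ k then δ * v else u) = (∏ k, if θ k then v else u) * δ ^ trueCount θ := by
    rw [trueCount, ← Finset.prod_pow_eq_pow_sum, ← Finset.prod_mul_distrib]
    refine Finset.prod_congr rfl fun k _ => ?_
    split_ifs <;> ring
  rw [h]
  rcases Nat.eq_zero_or_pos (trueCount θ) with h0 | h0
  · simp [h0]
  · obtain ⟨m, hm⟩ := Nat.exists_eq_succ_of_ne_zero h0.ne'
    simp [hm]
    ring

theorem horizCount_eq_trueCount (η : Crossing p → Bool) (c : Fin 3) :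
    horizCount η c = trueCount fun k => η ⟨c, k⟩ :=
  horizCount_eq_sum η c

theorem gapCount_pos (b : Fin 3 → Bool) : 0 < gapCount b := by
  have hb : b = ![b 0, b 1, b 2] := by
    ext c
    fin_cases c <;> rfl
  rw [hb, gapCount_eq]
  generalize b 0 = x, b 1 = y, b 2 = z
  revert x y z
  decide

theorem _root_.Finset.zpow_sum_eq_prod {M : Type*} [CommGroup M] {ι : Type*} (s : Finset ι) (a : M)
    (f : ι → ℤ) : a ^ (∑ i ∈ s, f i) = ∏ i ∈ s, a ^ f i := by
  classical
  induction s using Finset.induction_on with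
  | empty => simp
  | insert i s hi ih => rw [Finset.sum_insert hi, Finset.prod_insert hi, zpow_add, ih]

end Pretzel

namespace LinkDiagram

/-- The weight of a closed curve in the Kauffman bracket. -/
noncomputable def delta : ℤ[T;T⁻¹] :=
  -((A ^ (2 : ℤ) : (ℤ[T;T⁻¹])ˣ) : ℤ[T;T⁻¹]) - ((A ^ (-2 : ℤ) : (ℤ[T;T⁻¹])ˣ) : ℤ[T;T⁻¹])

end LinkDiagram

namespace Pretzel

open LinkDiagram

variable {p : Fin 3 → ℤ}

theorem smooth_diagram (hp : ∀ c, p c ≠ 0) (σ : Crossing p → Bool) (e : Crossing p × Corner) :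
    (diagram p hp).smooth σ e =
      (e.1, if decide (0 < p e.1.1) ^^ σ e.1 then e.2.flipH else e.2.flipV) := by
  change (if decide (0 < p e.1.1) = σ e.1 then (e.1, e.2.flipV) else (e.1, e.2.flipH)) = _
  cases h : decide (0 < p e.1.1) <;> cases h' : σ e.1 <;> rfl

theorem loops_diagram (hp : ∀ c, p c ≠ 0) (σ : Crossing p → Bool) :
    (diagram p hp).loops σ =
      gapCount (fun c => decide (0 < trueCount fun k => decide (0 < p c) ^^ σ ⟨c, k⟩)) +
        ∑ c, ((trueCount fun k => decide (0 < p c) ^^ σ ⟨c, k⟩) - 1) := by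
  have h := card_quot_stateRel hp fun x => decide (0 < p x.1) ^^ σ x
  simp only [horizCount_eq_trueCount] at h
  rw [← h]
  have hr : StateRel hp (fun x => decide (0 < p x.1) ^^ σ x) =
      fun e f => f = (diagram p hp).mate e ∨ f = (diagram p hp).smooth σ e := by
    funext e f
    rw [StateRel, ← smooth_diagram hp σ e]
    rfl
  rw [hr]
  exact add_zero _

/-- The weight of the vertical smoothing of a crossing of the tassel `c`; its inverse is that
of the horizontal smoothing. -/
noncomputable def vertWeight (p : Fin 3 → ℤ) (c : Fin 3) : (ℤ[T;T⁻¹])ˣ :=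
  if 0 < p c then A else A⁻¹

theorem weight_eq (c : Fin 3) (x : Bool) :
    ((A ^ (if x then (1 : ℤ) else -1) : (ℤ[T;T⁻¹])ˣ) : ℤ[T;T⁻¹]) =
      if decide (0 < p c) ^^ x then (((vertWeight p c)⁻¹ : (ℤ[T;T⁻¹])ˣ) : ℤ[T;T⁻¹]) else
        ((vertWeight p c : (ℤ[T;T⁻¹])ˣ) : ℤ[T;T⁻¹]) := by
  by_cases h : 0 < p c <;> cases x <;> simp [vertWeight, h]

theorem bracket_diagram (hp : ∀ c, p c ≠ 0) :
    (diagram p hp).bracket = ∑ b : Fin 3 → Bool, delta ^ (gapCount b - 1) *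
      ∏ c, tasselSum (p c).natAbs ((vertWeight p c : (ℤ[T;T⁻¹])ˣ) : ℤ[T;T⁻¹])
        ((vertWeight p c)⁻¹ : (ℤ[T;T⁻¹])ˣ) delta (b c) := by
  unfold tasselSum
  rw [← sum_prod_indicator (fun c (θ : Fin (p c).natAbs → Bool) => decide (0 < trueCount θ))
    (fun b => delta ^ (gapCount b - 1))]
  let E : (Crossing p → Bool) ≃ ∀ c : Fin 3, Fin (p c).natAbs → Bool :=
    { toFun := fun σ c k => decide (0 < p c) ^^ σ ⟨c, k⟩
      invFun := fun η x => decide (0 < p x.1) ^^ η x.1 x.2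
      left_inv := fun σ => by
        funext x
        simp
      right_inv := fun η => by
        funext c k
        simp }
  refine Fintype.sum_equiv E _ _ fun σ => ?_
  rw [loops_diagram, Finset.zpow_sum_eq_prod, Units.coe_prod]
  change (∏ x : Crossing p, _) * delta ^ _ = _
  -- Positivity of `gapCount` allows the `- 1` of the normalization to be charged to the curves
  -- between the tassels.
  rw [Fintype.prod_sigma, Nat.sub_add_comm (gapCount_pos _), pow_add,
    ← Finset.prod_pow_eq_pow_sum, mul_left_comm, ← Finset.prod_mul_distrib]
  refine congrArg _ (Finset.prod_congr rfl fun c _ => ?_)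
  exact congrArg (· * _) (Finset.prod_congr rfl fun k _ => weight_eq c _)

/-- `δ` times the contribution of the smoothings of the tassel `c` that contain a horizontal
one. -/
noncomputable def horizTerm (q : ℤ) : ℤ[T;T⁻¹] :=
  (((-A ^ (-3 : ℤ)) ^ q : (ℤ[T;T⁻¹])ˣ) : ℤ[T;T⁻¹]) - ((A ^ q : (ℤ[T;T⁻¹])ˣ) : ℤ[T;T⁻¹])

theorem vertWeight_pow (c : Fin 3) : vertWeight p c ^ (p c).natAbs = A ^ p c := by
  unfold vertWeight
  split_ifs with h
  · rw [← zpow_natCast, Int.natCast_natAbs, abs_of_pos h]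
  · rw [← zpow_natCast, Int.natCast_natAbs, abs_of_nonpos (by omega), inv_zpow', neg_neg]

theorem tasselSum_vertWeight_false (c : Fin 3) :
    tasselSum (p c).natAbs ((vertWeight p c : (ℤ[T;T⁻¹])ˣ) : ℤ[T;T⁻¹])
      ((vertWeight p c)⁻¹ : (ℤ[T;T⁻¹])ˣ) delta false = ((A ^ p c : (ℤ[T;T⁻¹])ˣ) : ℤ[T;T⁻¹]) := by
  rw [tasselSum_false, ← vertWeight_pow, Units.val_pow_eq_pow_val]

/-- With `u = A ^ (±1)` one has `u + δ u⁻¹ = -u ^ (-3)`, the factor of a Reidemeister I curl; this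
makes the formula uniform in the sign of `p c`. -/
theorem mul_tasselSum_vertWeight_true (c : Fin 3) :
    delta * tasselSum (p c).natAbs ((vertWeight p c : (ℤ[T;T⁻¹])ˣ) : ℤ[T;T⁻¹])
      ((vertWeight p c)⁻¹ : (ℤ[T;T⁻¹])ˣ) delta true = horizTerm (p c) := by
  rw [mul_tasselSum_true, ← Units.val_pow_eq_pow_val, vertWeight_pow, horizTerm]
  refine congrArg (· - _) ?_
  have hA : (A : ℤ[T;T⁻¹]) * (A⁻¹ : (ℤ[T;T⁻¹])ˣ) = 1 := A.mul_inv
  unfold vertWeight delta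
  split_ifs with h
  · have h1 : ((A : (ℤ[T;T⁻¹])ˣ) : ℤ[T;T⁻¹]) + (-((A ^ (2 : ℤ) : (ℤ[T;T⁻¹])ˣ) : ℤ[T;T⁻¹]) -
        ((A ^ (-2 : ℤ) : (ℤ[T;T⁻¹])ˣ) : ℤ[T;T⁻¹])) * (A⁻¹ : (ℤ[T;T⁻¹])ˣ) =
        ((-A ^ (-3 : ℤ) : (ℤ[T;T⁻¹])ˣ) : ℤ[T;T⁻¹]) := by
      rw [zpow_neg, zpow_neg, ← inv_zpow, ← inv_zpow]
      push_cast [zpow_ofNat]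
      linear_combination (-(A : ℤ[T;T⁻¹])) * hA
    rw [h1, ← Units.val_pow_eq_pow_val, ← zpow_natCast, Int.natCast_natAbs, abs_of_pos h]
  · have h1 : ((A⁻¹ : (ℤ[T;T⁻¹])ˣ) : ℤ[T;T⁻¹]) + (-((A ^ (2 : ℤ) : (ℤ[T;T⁻¹])ˣ) : ℤ[T;T⁻¹]) -
        ((A ^ (-2 : ℤ) : (ℤ[T;T⁻¹])ˣ) : ℤ[T;T⁻¹])) * ((A⁻¹)⁻¹ : (ℤ[T;T⁻¹])ˣ) =
        (((-A ^ (-3 : ℤ))⁻¹ : (ℤ[T;T⁻¹])ˣ) : ℤ[T;T⁻¹]) := by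
      rw [inv_neg, zpow_neg, zpow_neg, ← inv_zpow, inv_inv, inv_inv]
      push_cast [zpow_ofNat]
      linear_combination (-(A⁻¹ : (ℤ[T;T⁻¹])ˣ) : ℤ[T;T⁻¹]) * hA
    rw [h1, ← Units.val_pow_eq_pow_val, ← zpow_natCast, Int.natCast_natAbs,
      abs_of_nonpos (by omega), inv_zpow', neg_neg]

theorem sum_fin_three_bool {M : Type*} [AddCommMonoid M] (f : (Fin 3 → Bool) → M) :
    ∑ b, f b = ∑ x, ∑ y, ∑ z, f ![x, y, z] := by
  let E : Bool × Bool × Bool ≃ (Fin 3 → Bool) :=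
    { toFun := fun t => ![t.1, t.2.1, t.2.2]
      invFun := fun b => (b 0, b 1, b 2)
      left_inv := fun _ => rfl
      right_inv := fun b => by
        ext c
        fin_cases c <;> rfl }
  rw [← E.sum_comp]
  simp only [Fintype.sum_prod_type]
  rfl

/-- With `k` horizontal tassels, `δ ^ (gapCount - 1)` is `δ ^ (2 - k)` for `k ≤ 2` and `δ` for `k =
3`. Each `horizTerm` absorbs one `δ`, so the factor `δ ^ 2` is just enough to avoid division. -/
theorem delta_sq_mul_bracket (hp : ∀ c, p c ≠ 0) :
    delta ^ 2 * (diagram p hp).bracket =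
      delta ^ 4 * ((A ^ p 0 : (ℤ[T;T⁻¹])ˣ) * (A ^ p 1 : (ℤ[T;T⁻¹])ˣ) * (A ^ p 2 : (ℤ[T;T⁻¹])ˣ))
      + delta ^ 2 * ((A ^ p 0 : (ℤ[T;T⁻¹])ˣ) * (A ^ p 1 : (ℤ[T;T⁻¹])ˣ) * horizTerm (p 2) +
          (A ^ p 0 : (ℤ[T;T⁻¹])ˣ) * horizTerm (p 1) * (A ^ p 2 : (ℤ[T;T⁻¹])ˣ) +
          horizTerm (p 0) * (A ^ p 1 : (ℤ[T;T⁻¹])ˣ) * (A ^ p 2 : (ℤ[T;T⁻¹])ˣ))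
      + ((A ^ p 0 : (ℤ[T;T⁻¹])ˣ) * horizTerm (p 1) * horizTerm (p 2) +
          horizTerm (p 0) * (A ^ p 1 : (ℤ[T;T⁻¹])ˣ) * horizTerm (p 2) +
          horizTerm (p 0) * horizTerm (p 1) * (A ^ p 2 : (ℤ[T;T⁻¹])ˣ))
      + horizTerm (p 0) * horizTerm (p 1) * horizTerm (p 2) := by
  rw [bracket_diagram, sum_fin_three_bool]
  simp only [Fintype.sum_bool, Fin.prod_univ_three, gapCount_eq, Matrix.cons_val_zero,
    Matrix.cons_val_one, Matrix.cons_val, tasselSum_vertWeight_false]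
  simp only [← mul_tasselSum_vertWeight_true]
  simp
  ring

end Pretzel

/-! ### The writhe. -/

namespace Pretzel

variable {p : Fin 3 → ℤ}

section Writhe

variable {hp : ∀ c, p c ≠ 0} (o : (diagram p hp).Orientation)

theorem out_SE (x : Crossing p) : o.out (x, .SE) = !o.out (x, .NW) :=
  o.out_opposite x .NW

theorem out_SW (x : Crossing p) : o.out (x, .SW) = !o.out (x, .NE) :=
  o.out_opposite x .NE

theorem out_succ (c : Fin 3) (k : ℕ) (hk : k + 1 < (p c).natAbs) :
    o.out (⟨c, k + 1, hk⟩, .NW) = o.out (⟨c, k, by omega⟩, .NE) ∧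
      o.out (⟨c, k + 1, hk⟩, .NE) = o.out (⟨c, k, by omega⟩, .NW) := by
  have h1 := o.out_mate (⟨c, k, by omega⟩, .SW)
  have h2 := o.out_mate (⟨c, k, by omega⟩, .SE)
  rw [out_SW, Bool.not_not] at h1
  rw [out_SE, Bool.not_not] at h2
  simp only [diagram, mate, hk, dif_pos] at h1 h2
  exact ⟨h1, h2⟩

theorem out_eq_top (c : Fin 3) (k : ℕ) (hk : k < (p c).natAbs) :
    o.out (⟨c, k, hk⟩, .NW) = o.out (top hp c, if k % 2 = 0 then .NW else .NE) ∧
      o.out (⟨c, k, hk⟩, .NE) = o.out (top hp c, if k % 2 = 0 then .NE else .NW) := by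
  induction k with
  | zero => exact ⟨rfl, rfl⟩
  | succ k ih =>
    obtain ⟨h1, h2⟩ := out_succ o c k hk
    obtain ⟨h3, h4⟩ := ih (by omega)
    rw [h1, h2, h3, h4]
    rcases Nat.mod_two_eq_zero_or_one k with h | h <;> simp [h, Nat.add_mod]

/-- In a column of odd length the bottom crossing has even index, hence is oriented like the top
one; the arcs at both ends then carry the orientation to the next column. -/
theorem out_top_succ (hodd : ∀ c, Odd (p c)) (c : Fin 3) :
    o.out (top hp (c + 1), .NW) = !o.out (top hp c, .NE) ∧
      o.out (top hp (c + 1), .NE) = !o.out (top hp c, .NW) := by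
  have hb : ∀ c, o.out (bottom hp c, .NW) = o.out (top hp c, .NW) ∧
      o.out (bottom hp c, .NE) = o.out (top hp c, .NE) := fun c => by
    have h := out_eq_top o c ((p c).natAbs - 1) (bottom hp c).2.2
    have h1 := Nat.odd_iff.mp (Int.natAbs_odd.mpr (hodd c))
    rw [if_pos (by omega), if_pos (by omega)] at h
    exact h
  constructor
  · exact o.out_mate (top hp c, .NE)
  · have h : o.out (mate hp (bottom hp c, .SE)) = !o.out (bottom hp c, .SE) :=
      o.out_mate (bottom hp c, .SE)
    have h1 : mate hp (bottom hp c, .SE) = (bottom hp (c + 1), .SW) := by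
      have := Int.natAbs_pos.mpr (hp c)
      exact dif_neg (show ¬ ((p c).natAbs - 1 + 1 < (p c).natAbs) by omega)
    have h2 := (out_SW o (bottom hp (c + 1))).symm.trans ((congrArg o.out h1).symm.trans h)
    rw [out_SE, (hb c).1, (hb (c + 1)).2, Bool.not_not] at h2
    rw [← h2, Bool.not_not]

/-- Passing to the next column swaps and negates the two upper directions. Three such steps, an odd
number, return to the start, which forces antiparallel strands. -/
theorem out_NW (hodd : ∀ c, Odd (p c)) (x : Crossing p) :
    o.out (x, .NW) = !o.out (x, .NE) := by
  have key : ∀ c, o.out (top hp c, .NW) = !o.out (top hp c, .NE) := fun c => by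
    obtain ⟨h1, h1'⟩ := out_top_succ o hodd c
    obtain ⟨h2, h2'⟩ := out_top_succ o hodd (c + 1)
    obtain ⟨h3, h3'⟩ := out_top_succ o hodd (c + 1 + 1)
    have h0 : c + 1 + 1 + 1 = c := by
      rw [add_assoc, add_assoc]
      exact add_zero c
    rw [h2', h1, h0, Bool.not_not] at h3
    exact h3
  rcases x with ⟨c, k, hk⟩
  obtain ⟨h1, h2⟩ := out_eq_top o c k hk
  rw [h1, h2]
  split_ifs
  · exact key c
  · rw [key c, Bool.not_not]

/-- If the three numbers are odd, then the two strands of each tassel are antiparallel for every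
orientation. -/
theorem writhe_eq (hodd : ∀ c, Odd (p c)) : o.writhe = -(∑ c, p c) := by
  have hs : ∀ x : Crossing p, o.sign x = if 0 < p x.1 then -1 else 1 := fun x => by
    have := out_NW o hodd x
    have hs : o.sign x =
      if decide (0 < p x.1) = (o.out (x, .NW) == o.out (x, .NE)) then 1 else -1 := rfl
    simp only [hs, this]
    cases o.out (x, .NE) <;> by_cases h : 0 < p x.1 <;> simp [h]
  change ∑ x : Crossing p, o.sign x = _
  simp only [hs, Fintype.sum_sigma]
  rw [← Finset.sum_neg_distrib]
  refine Finset.sum_congr rfl fun c _ => ?_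
  split_ifs <;> simp <;> omega

end Writhe

/-! ### Alternating sums of powers of `t`. -/

theorem alternating_sum_mul {R : Type*} [CommRing R] {t t' : R} (h : t * t' = 1) (m : ℕ) :
    (t + t' + 2) * ∑ j ∈ Finset.Icc 1 m, (-1) ^ (j + 1) * (t ^ j + t' ^ j) =
      t + t' + 2 - (-1) ^ m * (t ^ m + t' ^ m + t ^ (m + 1) + t' ^ (m + 1)) := by
  induction m with
  | zero => simp; ring
  | succ m ih =>
    rw [Finset.sum_Icc_succ_top (by omega), mul_add, ih]
    simp only [pow_succ]
    linear_combination ((-1) ^ m * (t ^ m + t' ^ m)) * h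

/-- The Fejér kernel at `-t`. -/
theorem fejer_sum_mul {R : Type*} [CommRing R] {t t' : R} (h : t * t' = 1) (m : ℕ) :
    (t + t' + 2) * ∑ j ∈ Finset.Icc 1 m, (-1) ^ (j + 1) * ((m : R) + 1 - j) * (t ^ j + t' ^ j) =
      (m + 1) * (t + t' + 2) + (-1) ^ (m + 1) * (t ^ (m + 1) + t' ^ (m + 1)) - 2 := by
  induction m with
  | zero => simp; ring
  | succ m ih =>
    -- Raising `m` by one raises every weight by one, so the Fejér sum grows by a plain alternating
    -- sum; the new index `m + 1` has weight zero in the old sum.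
    have hsum : ∑ j ∈ Finset.Icc 1 (m + 1),
        (-1) ^ (j + 1) * (((m + 1 : ℕ) : R) + 1 - j) * (t ^ j + t' ^ j) =
        ∑ j ∈ Finset.Icc 1 m, (-1) ^ (j + 1) * ((m : R) + 1 - j) * (t ^ j + t' ^ j) +
          ∑ j ∈ Finset.Icc 1 (m + 1), (-1) ^ (j + 1) * (t ^ j + t' ^ j) := by
      have : ∑ j ∈ Finset.Icc 1 m, (-1) ^ (j + 1) * ((m : R) + 1 - j) * (t ^ j + t' ^ j) =
          ∑ j ∈ Finset.Icc 1 (m + 1), (-1) ^ (j + 1) * ((m : R) + 1 - j) * (t ^ j + t' ^ j) := by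
        rw [Finset.sum_Icc_succ_top (by omega)]
        simp
      rw [this, ← Finset.sum_add_distrib]
      refine Finset.sum_congr rfl fun j _ => ?_
      push_cast
      ring
    rw [hsum, mul_add, ih, alternating_sum_mul h]
    push_cast
    ring

end Pretzel

/-! ### Powers of `t` and the curve weight `δ`. -/

namespace LinkDiagram

theorem tPow_eq (k : ℤ) : tPow k = ((A ^ (-k) : (ℤ[T;T⁻¹])ˣ) : ℤ[T;T⁻¹]) ^ 4 := by
  rw [tPow, ← Units.val_pow_eq_pow_val, ← zpow_mul, ← zpow_natCast, ← zpow_mul]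
  congr 2
  push_cast
  ring

theorem tPow_natCast (j : ℕ) : tPow j = tPow 1 ^ j := by
  rw [tPow, tPow, ← Units.val_pow_eq_pow_val, zpow_one, zpow_natCast]

theorem tPow_neg_natCast (j : ℕ) : tPow (-j) = tPow (-1) ^ j := by
  rw [tPow, tPow, ← Units.val_pow_eq_pow_val, zpow_neg, zpow_natCast, zpow_neg_one, inv_pow]

theorem tPow_one_mul : tPow 1 * tPow (-1) = 1 := by
  rw [tPow, tPow, ← Units.val_mul, ← zpow_add]
  simp

theorem delta_sq : delta ^ 2 = tPow 1 + tPow (-1) + 2 := by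
  have h : ((A ^ (2 : ℤ) : (ℤ[T;T⁻¹])ˣ) : ℤ[T;T⁻¹]) * ((A ^ (-2 : ℤ) : (ℤ[T;T⁻¹])ˣ) : ℤ[T;T⁻¹]) =
      1 := by
    rw [← Units.val_mul, ← zpow_add]
    simp
  have h1 : tPow 1 = ((A ^ (-2 : ℤ) : (ℤ[T;T⁻¹])ˣ) : ℤ[T;T⁻¹]) ^ 2 := by
    rw [tPow, ← Units.val_pow_eq_pow_val, ← zpow_natCast, ← zpow_mul, ← zpow_mul]
    rfl
  have h2 : tPow (-1) = ((A ^ (2 : ℤ) : (ℤ[T;T⁻¹])ˣ) : ℤ[T;T⁻¹]) ^ 2 := by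
    rw [tPow, ← Units.val_pow_eq_pow_val, ← zpow_natCast, ← zpow_mul, ← zpow_mul]
    rfl
  rw [h1, h2, delta]
  linear_combination 2 * h

theorem delta_ne_zero : delta ≠ 0 := by
  intro h
  -- At `A = 1` the value of `δ` is `-2`.
  have h1 := congrArg (LaurentPolynomial.eval₂ (RingHom.id ℤ) 1) h
  have hA : LaurentPolynomial.eval₂ (RingHom.id ℤ) 1 (A : ℤ[T;T⁻¹]) = 1 := by
    change LaurentPolynomial.eval₂ (RingHom.id ℤ) 1 (LaurentPolynomial.T 1) = 1
    simp
  have hA' : Units.map (LaurentPolynomial.eval₂ (RingHom.id ℤ) 1 : ℤ[T;T⁻¹] →+* ℤ).toMonoidHom A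
      = 1 := Units.ext hA
  have hz : ∀ k : ℤ, LaurentPolynomial.eval₂ (RingHom.id ℤ) 1 ((A ^ k : (ℤ[T;T⁻¹])ˣ) : ℤ[T;T⁻¹])
      = 1 := fun k => by
    have := congrArg Units.val (map_zpow
      (Units.map (LaurentPolynomial.eval₂ (RingHom.id ℤ) 1 : ℤ[T;T⁻¹] →+* ℤ).toMonoidHom) A k)
    rw [hA', one_zpow] at this
    exact this
  rw [delta, map_sub, map_neg, hz, hz, map_zero] at h1
  norm_num at h1

end LinkDiagram

/-! ### The final identity. -/

namespace Pretzel

open LinkDiagram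

theorem horizTerm_of_odd {q : ℤ} (hq : Odd q) :
    horizTerm q = -((A ^ (-q) : (ℤ[T;T⁻¹])ˣ) : ℤ[T;T⁻¹]) ^ 3 -
      ((A ^ q : (ℤ[T;T⁻¹])ˣ) : ℤ[T;T⁻¹]) := by
  rw [horizTerm, hq.neg_zpow, ← zpow_mul, Units.val_neg, ← Units.val_pow_eq_pow_val,
    ← zpow_natCast, ← zpow_mul]
  congr 4
  push_cast
  ring

/-- Here `α = A ^ (2s+1)` and `ν = A ^ (2i+1)`. In the last two groups the coefficient of the third
`horizTerm`, namely `-ν' ^ 3 - ν`, cancels: with that tassel horizontal, the opposite columns form a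
two-component unlink. -/
theorem sq_delta_mul_jones_eq {R : Type*} [CommRing R] {δ α α' ν ν' : R} (hα : α * α' = 1)
    (hν : ν * ν' = 1) :
    -ν ^ 3 * (δ ^ 4 * (α' * α * ν) +
      δ ^ 2 * (α' * α * (-ν' ^ 3 - ν) + α' * (-α' ^ 3 - α) * ν + (-α ^ 3 - α') * α * ν) +
      (α' * (-α' ^ 3 - α) * (-ν' ^ 3 - ν) + (-α ^ 3 - α') * α * (-ν' ^ 3 - ν) +
        (-α ^ 3 - α') * (-α' ^ 3 - α) * ν) +
      (-α ^ 3 - α') * (-α' ^ 3 - α) * (-ν' ^ 3 - ν)) =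
    δ ^ 2 + ν ^ 4 * ((δ ^ 2 - 1) * (α' ^ 4 + α ^ 4 + 2 - δ ^ 2)) := by
  have hν3 : ν ^ 3 * ν' ^ 3 = 1 := by rw [← mul_pow, hν, one_pow]
  have h1 : α' * (-α' ^ 3 - α) = -α' ^ 4 - 1 := by linear_combination -hα
  have h2 : (-α ^ 3 - α') * α = -α ^ 4 - 1 := by linear_combination -hα
  have h3 : (-α ^ 3 - α') * (-α' ^ 3 - α) = α ^ 4 + α' ^ 4 + 2 := by
    have hα3 : α ^ 3 * α' ^ 3 = 1 := by rw [← mul_pow, hα, one_pow]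
    linear_combination hα3 + hα
  rw [h1, h2, h3, mul_comm α' α, hα]
  linear_combination δ ^ 2 * hν3

end Pretzel

theorem theorem4p2 (s i : ℕ) (hs : 1 ≤ s) (hi : (s : ℚ) + 3 / 2 < (i : ℚ))
    (o : (pretzel (-(2 * (s : ℤ) + 1)) (2 * (s : ℤ) + 1) (2 * (i : ℤ) + 1)
      (by omega) (by omega) (by omega)).Orientation) :
    LinkDiagram.jones _ o =
      1 + LinkDiagram.tPow (-2 * (i : ℤ) - 1) *
        (LinkDiagram.tPow (2 * (s : ℤ) + 1) + LinkDiagram.tPow (-(2 * (s : ℤ) + 1))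
          - (LinkDiagram.tPow 1 + LinkDiagram.tPow (-1))
          - 2 * (s : ℤ[T;T⁻¹])
          + ∑ j ∈ Finset.Icc 1 (2 * s),
              (-1) ^ (j + 1) * (2 * (s : ℤ[T;T⁻¹]) + 1 - (j : ℤ[T;T⁻¹])) *
                (LinkDiagram.tPow (j : ℤ) + LinkDiagram.tPow (-(j : ℤ)))) := by
  have ha : Odd (2 * (s : ℤ) + 1) := ⟨s, rfl⟩
  have hN : Odd (2 * (i : ℤ) + 1) := ⟨i, rfl⟩
  have hw : o.writhe = -(2 * (i : ℤ) + 1) := by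
    refine (Pretzel.writhe_eq o fun c => ?_).trans ?_
    · fin_cases c
      · exact ha.neg
      · exact ha
      · exact hN
    · simp [Fin.sum_univ_three]
  have hb := Pretzel.delta_sq_mul_bracket (p := ![-(2 * (s : ℤ) + 1), 2 * (s : ℤ) + 1,
    2 * (i : ℤ) + 1]) (by intro j; fin_cases j <;> simp <;> omega)
  simp only [Matrix.cons_val_zero, Matrix.cons_val_one, Matrix.cons_val,
    Pretzel.horizTerm_of_odd ha, Pretzel.horizTerm_of_odd ha.neg, Pretzel.horizTerm_of_odd hN,
    neg_neg] at hb
  have hj : ∀ a b : ℤ, a + b = 0 → ((LinkDiagram.A ^ a : (ℤ[T;T⁻¹])ˣ) : ℤ[T;T⁻¹]) *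
      ((LinkDiagram.A ^ b : (ℤ[T;T⁻¹])ˣ) : ℤ[T;T⁻¹]) = 1 := fun a b h => by
    rw [← Units.val_mul, ← zpow_add, h, zpow_zero, Units.val_one]
  have hsum := Pretzel.fejer_sum_mul LinkDiagram.tPow_one_mul (2 * s)
  have hneg : (((-LinkDiagram.A) ^ (-3 * o.writhe) : (ℤ[T;T⁻¹])ˣ) : ℤ[T;T⁻¹]) =
      -((LinkDiagram.A ^ (2 * (i : ℤ) + 1) : (ℤ[T;T⁻¹])ˣ) : ℤ[T;T⁻¹]) ^ 3 := by
    rw [hw, Odd.neg_zpow ((by decide : Odd (-3 : ℤ)).mul hN.neg), Units.val_neg,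
      ← Units.val_pow_eq_pow_val, ← zpow_natCast, ← zpow_mul]
    congr 3
    push_cast
    ring
  have htop : (-1 : ℤ[T;T⁻¹]) ^ (2 * s + 1) = -1 := Odd.neg_one_pow ⟨s, rfl⟩
  rw [← LinkDiagram.tPow_natCast, ← LinkDiagram.tPow_neg_natCast, htop,
    ← LinkDiagram.delta_sq] at hsum
  simp only [← LinkDiagram.tPow_natCast, ← LinkDiagram.tPow_neg_natCast] at hsum
  push_cast at hsum
  -- The bracket is known only up to the factor `δ ^ 2`, and the Fejér identity carries the same
  -- factor.
  refine mul_left_cancel₀ (pow_ne_zero 2 LinkDiagram.delta_ne_zero) ?_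
  rw [LinkDiagram.jones, hneg, mul_left_comm]
  refine (congrArg _ hb).trans ?_
  rw [Pretzel.sq_delta_mul_jones_eq (hj _ _ (by ring)) (hj _ (-(2 * (i : ℤ) + 1)) (by ring))]
  have e1 : LinkDiagram.tPow (-2 * (i : ℤ) - 1) =
      ((LinkDiagram.A ^ (2 * (i : ℤ) + 1) : (ℤ[T;T⁻¹])ˣ) : ℤ[T;T⁻¹]) ^ 4 := by
    rw [LinkDiagram.tPow_eq]
    ring_nf
  rw [e1]
  simp only [LinkDiagram.tPow_eq (2 * (s : ℤ) + 1), LinkDiagram.tPow_eq (-(2 * (s : ℤ) + 1)),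
    neg_neg] at hsum ⊢
  -- `hsum` replaces `δ ^ 2` times the alternating sum; `delta_sq` replaces `t + t⁻¹` in the claim
  -- by `δ ^ 2 - 2`.
  linear_combination
    (-((LinkDiagram.A ^ (2 * (i : ℤ) + 1) : (ℤ[T;T⁻¹])ˣ) : ℤ[T;T⁻¹]) ^ 4) * hsum +
    (-((LinkDiagram.A ^ (2 * (i : ℤ) + 1) : (ℤ[T;T⁻¹])ˣ) : ℤ[T;T⁻¹]) ^ 4 *
      LinkDiagram.delta ^ 2) * LinkDiagram.delta_sq
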